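/- For $\lambda\in\mathbb{C}\setminus\{0\}$ let $F_\lambda(z)=z^2+\lambda/z^2$, regarded as a map of the Riemann sphere $\widehat{\mathbb{C}}=\mathbb{C}\cup\{\infty\}$ to itself with $F_\lambda(0)=F_\lambda(\infty)=\infty$, and let its Julia set $J(F_\lambda)$ be the boundary in $\widehat{\mathbb{C}}$ of the set of points $z$ whose orbits $F_\lambda^n(z)$ tend to $\infty$ as $n\to\infty$. Then for every $\varepsilon>0$ there is $\gamma>0$ such that, for every $\lambda\in\mathbb{C}$ with $0<|\lambda|\le\gamma$ and every $z\in\mathbb{C}$ with $|z|\le 1$, the Julia set $J(F_\lambda)$ meets the open disk $B_\varepsilon(z)=\{w\in\mathbb{C}:|w-z|<\varepsilon\}$. -/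

import Mathlib

open scoped OnePoint

/-- The map `z ↦ z ^ 2 + c / z ^ 2` for `c ≠ 0`, as a self-map of the Riemann sphere `ℂ ∪ {∞}`:
both the pole `0` and the point `∞` are sent to `∞`. -/
noncomputable def singularMap (c : ℂ) : OnePoint ℂ → OnePoint ℂ
  | ∞ => ∞
  | OnePoint.some z => if z = 0 then ∞ else ((z ^ 2 + c / z ^ 2 : ℂ) : OnePoint ℂ)

/-- The set of points of the Riemann sphere whose forward orbit under `F` tends to `∞`
(an orbit that lands on `∞` and stays there counts). -/
def escapingSet (F : OnePoint ℂ → OnePoint ℂ) : Set (OnePoint ℂ) :=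
  {x | Filter.Tendsto (fun n : ℕ => F^[n] x) Filter.atTop (nhds ∞)}

/-- The Julia set of `F`: the topological boundary, in the Riemann sphere, of the set of points
whose orbits tend to `∞`. -/
def juliaSet (F : OnePoint ℂ → OnePoint ℂ) : Set (OnePoint ℂ) :=
  frontier (escapingSet F)

/-! Put `s = ‖c‖ ^ (1/4)`, so that the critical points lie on the circle `‖z‖ = s`. A disk that
misses the Julia set lies, by connectedness, in the escaping set or in its complement. Both are
totally invariant, and it is shown that a totally invariant `X` containing the disk contains the
annulus `s / 2 < ‖z‖ < 2 * s`. That annulus holds an escaping point (a preimage of the pole) and a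
non-escaping one (an iterated preimage of a fixed point near `1`), a contradiction.

To reach the annulus, note that away from `0` the map is nearly squaring, so a fixed iterate spreads
the disk over a thick round annulus, uniformly in small `c` (`exists_containsAnnulus_of_exp`).
Further images of this annulus grow in ratio, while the symmetry `z ↦ √c / z` brings them back
outside the critical circle; the ratio there is at most `1 / s`, so the annulus must eventually
straddle the circle (`ContainsAnnulus.critical`). Compactness of the closed unit disk makes `γ`
independent of the centre. -/

theorem singularMap_coe {c z : ℂ} (hz : z ≠ 0) :
    singularMap c (z : OnePoint ℂ) = ((z ^ 2 + c / z ^ 2 : ℂ) : OnePoint ℂ) := by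
  change (if z = 0 then _ else _) = _
  rw [if_neg hz]

theorem singularMap_infty (c : ℂ) : singularMap c ∞ = ∞ := rfl

theorem singularMap_zero (c : ℂ) : singularMap c ((0 : ℂ) : OnePoint ℂ) = ∞ := by
  change (if (0 : ℂ) = 0 then _ else _) = _
  rw [if_pos rfl]

theorem mem_escapingSet_iff (F : OnePoint ℂ → OnePoint ℂ) (x : OnePoint ℂ) :
    F x ∈ escapingSet F ↔ x ∈ escapingSet F := by
  simp only [escapingSet, Set.mem_ofPred_eq]
  rw [← Filter.tendsto_add_atTop_iff_nat (f := fun n => F^[n] x) 1]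
  simp only [Function.iterate_succ_apply]

theorem infty_mem_escapingSet (c : ℂ) : ∞ ∈ escapingSet (singularMap c) := by
  simp only [escapingSet, Set.mem_ofPred_eq, Function.iterate_fixed (singularMap_infty c)]
  exact tendsto_const_nhds

theorem coe_notMem_escapingSet_of_isFixedPt {F : OnePoint ℂ → OnePoint ℂ} {p : ℂ}
    (hp : F p = p) : (p : OnePoint ℂ) ∉ escapingSet F := by
  simp only [escapingSet, Set.mem_ofPred_eq, Function.iterate_fixed hp]
  intro h
  exact OnePoint.coe_ne_infty p (tendsto_nhds_unique tendsto_const_nhds h)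

/-! ### Preimages outside the critical circle. -/

/-- Every `w` is the sum of two numbers with product `c`, listed by size. -/
theorem exists_add_mul_eq (c w : ℂ) : ∃ u v : ℂ, u + v = w ∧ u * v = c ∧ ‖v‖ ≤ ‖u‖ := by
  obtain ⟨d, hd⟩ := IsAlgClosed.exists_pow_nat_eq (w ^ 2 - 4 * c) (n := 2) (by norm_num)
  rcases le_total ‖(w - d) / 2‖ ‖(w + d) / 2‖ with h | h
  · exact ⟨_, _, by ring, by linear_combination -hd / 4, h⟩
  · exact ⟨_, _, by ring, by linear_combination -hd / 4, h⟩

theorem norm_ge_of_mul_eq {c u v : ℂ} {s : ℝ} (hc : ‖c‖ = s ^ 4) (h : u * v = c)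
    (hvu : ‖v‖ ≤ ‖u‖) : s ^ 2 ≤ ‖u‖ := by
  have h1 : ‖u‖ * ‖v‖ = s ^ 4 := by rw [← norm_mul, h, hc]
  by_contra! h2
  nlinarith [norm_nonneg u, norm_nonneg v, mul_le_mul_of_nonneg_left hvu (norm_nonneg u)]

theorem exists_preimage_norm_ge {c : ℂ} {s : ℝ} (hs : 0 < s) (hc : ‖c‖ = s ^ 4) (w : ℂ) :
    ∃ z : ℂ, s ≤ ‖z‖ ∧ z ^ 2 + c / z ^ 2 = w := by
  obtain ⟨u, v, huv, hm, hle⟩ := exists_add_mul_eq c w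
  have h1 := norm_ge_of_mul_eq hc hm hle
  have hu : u ≠ 0 := norm_pos_iff.1 (lt_of_lt_of_le (by positivity) h1)
  obtain ⟨z, hz⟩ := IsAlgClosed.exists_pow_nat_eq u (n := 2) (by norm_num)
  refine ⟨z, ?_, ?_⟩
  · rw [← hz, norm_pow] at h1
    exact (sq_le_sq₀ hs.le (norm_nonneg z)).1 h1
  · rw [hz, ← huv, ← hm, mul_div_cancel_left₀ _ hu]

theorem norm_image_le {c z : ℂ} {s : ℝ} (hc : ‖c‖ = s ^ 4) :
    ‖z ^ 2 + c / z ^ 2‖ ≤ ‖z‖ ^ 2 + s ^ 4 / ‖z‖ ^ 2 := by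
  refine (norm_add_le _ _).trans ?_
  rw [norm_div, norm_pow, hc]

theorem le_norm_image {c z : ℂ} {s : ℝ} (hc : ‖c‖ = s ^ 4) :
    ‖z‖ ^ 2 - s ^ 4 / ‖z‖ ^ 2 ≤ ‖z ^ 2 + c / z ^ 2‖ := by
  have := norm_sub_le_norm_add (z ^ 2) (c / z ^ 2)
  rwa [norm_div, norm_pow, hc] at this

/-! ### Round annuli in totally invariant sets. -/

/-- The set of finite points of `X` contains the round annulus with radii `a` and `b`. -/
def ContainsAnnulus (X : Set (OnePoint ℂ)) (a b : ℝ) : Prop :=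
  ∀ z : ℂ, a < ‖z‖ → ‖z‖ < b → (z : OnePoint ℂ) ∈ X

theorem ContainsAnnulus.mono {X : Set (OnePoint ℂ)} {a b a' b' : ℝ} (h : ContainsAnnulus X a b)
    (ha : a ≤ a') (hb : b' ≤ b) : ContainsAnnulus X a' b' :=
  fun z h1 h2 => h z (ha.trans_lt h1) (h2.trans_le hb)

/-- Every `w` has a preimage with `‖z‖ ≥ s`. There the upper bound `t ^ 2 + s ^ 4 / t ^ 2` for the
image modulus and the lower bound `t ^ 2 - s ^ 4 / t ^ 2` both increase with `t = ‖z‖`, which forces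
`a < ‖z‖ < b`. -/
theorem ContainsAnnulus.image {X : Set (OnePoint ℂ)} {a b s : ℝ} {c : ℂ} (hs : 0 < s)
    (hc : ‖c‖ = s ^ 4) (hX : ∀ x, singularMap c x ∈ X ↔ x ∈ X) (h : ContainsAnnulus X a b)
    (ha : s ≤ a) (hb : 0 < b) :
    ContainsAnnulus X (a ^ 2 + s ^ 4 / a ^ 2) (b ^ 2 - s ^ 4 / b ^ 2) := by
  intro w h1 h2
  obtain ⟨z, hsz, rfl⟩ := exists_preimage_norm_ge hs hc w
  have hz : 0 < ‖z‖ := hs.trans_le hsz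
  have ha0 : 0 < a := hs.trans_le ha
  rw [← singularMap_coe (norm_pos_iff.1 hz), hX]
  apply h
  · by_contra! hle
    have h3 := h1.trans_le (norm_image_le hc)
    have h4 : ‖z‖ ^ 2 ≤ a ^ 2 := by gcongr
    have h5 : s ^ 2 ≤ ‖z‖ ^ 2 := by gcongr
    have h6 : s ^ 4 / (a ^ 2 * ‖z‖ ^ 2) ≤ 1 := by
      rw [div_le_one (by positivity)]
      nlinarith [sq_nonneg s]
    have h7 : a ^ 2 + s ^ 4 / a ^ 2 - (‖z‖ ^ 2 + s ^ 4 / ‖z‖ ^ 2)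
        = (a ^ 2 - ‖z‖ ^ 2) * (1 - s ^ 4 / (a ^ 2 * ‖z‖ ^ 2)) := by
      field_simp
      ring
    nlinarith [mul_nonneg (sub_nonneg.2 h4) (sub_nonneg.2 h6)]
  · by_contra! hle
    have h3 := (le_norm_image hc).trans_lt h2
    have h4 : b ^ 2 ≤ ‖z‖ ^ 2 := by gcongr
    have h5 : s ^ 4 / ‖z‖ ^ 2 ≤ s ^ 4 / b ^ 2 := by gcongr
    linarith

/-- With `d ^ 2 = c`, the points `z` and `d / z` have the same image, so `X` is invariant under this
inversion in the critical circle. -/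
theorem ContainsAnnulus.flip {X : Set (OnePoint ℂ)} {a b s : ℝ} {c : ℂ} (hs : 0 < s)
    (hc : ‖c‖ = s ^ 4) (hX : ∀ x, singularMap c x ∈ X ↔ x ∈ X) (h : ContainsAnnulus X a b)
    (ha : 0 < a) (hb : 0 < b) : ContainsAnnulus X (s ^ 2 / b) (s ^ 2 / a) := by
  intro z h1 h2
  obtain ⟨d, hd⟩ := IsAlgClosed.exists_pow_nat_eq c (n := 2) (by norm_num)
  have hds : ‖d‖ = s ^ 2 := by
    rw [← sq_eq_sq₀ (norm_nonneg d) (by positivity), ← norm_pow, hd, hc]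
    ring
  have hd0 : d ≠ 0 := norm_pos_iff.1 (by rw [hds]; positivity)
  have hzpos : 0 < ‖z‖ := lt_trans (by positivity) h1
  have hz : z ≠ 0 := norm_pos_iff.1 hzpos
  have h3 : ((d / z : ℂ) : OnePoint ℂ) ∈ X := by
    apply h
    · rw [norm_div, hds, lt_div_iff₀ hzpos]
      rw [lt_div_iff₀ ha] at h2
      linarith
    · rw [norm_div, hds, div_lt_iff₀ hzpos]
      rw [div_lt_iff₀ hb] at h1
      linarith
  rw [← hX, singularMap_coe (div_ne_zero hd0 hz)] at h3
  rw [← hX, singularMap_coe hz]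
  convert h3 using 2
  rw [← hd]
  field_simp
  ring

/-- A round annulus of modulus ratio at least `16` in a totally invariant set has a forward image
that contains the critical circle together with a definite collar. -/
theorem ContainsAnnulus.critical {X : Set (OnePoint ℂ)} {s : ℝ} {c : ℂ} (hs : 0 < s)
    (hc : ‖c‖ = s ^ 4) (hX : ∀ x, singularMap c x ∈ X ↔ x ∈ X) (n : ℕ) :
    ∀ a b : ℝ, s ≤ a → b ≤ 1 → 16 * a ≤ b → a < 2 ^ n * b * s → ContainsAnnulus X a b →
      ContainsAnnulus X (s / 2) (2 * s) := by
  -- `n` bounds the number of doublings of `b / a` before it exceeds `1 / s`, which is impossible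
  -- when `s ≤ a` and `b ≤ 1`.
  induction n with
  | zero =>
    intro a b ha hb _ h
    nlinarith
  | succ n ih =>
    intro a b ha hb hab hn h
    have ha0 : 0 < a := hs.trans_le ha
    have hb0 : 0 < b := by linarith
    have himg := h.image hs hc hX ha hb0
    set a' := a ^ 2 + s ^ 4 / a ^ 2 with ha'
    set b' := b ^ 2 - s ^ 4 / b ^ 2 with hb'
    have hb'1 : b' ≤ 1 := by
      have : 0 ≤ s ^ 4 / b ^ 2 := by positivity
      nlinarith
    have ha'pos : 0 < a' := by positivity
    have hsa : s ^ 4 / a ^ 2 ≤ a ^ 2 := by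
      rw [div_le_iff₀ (by positivity)]
      calc s ^ 4 ≤ a ^ 4 := by gcongr
        _ = a ^ 2 * a ^ 2 := by ring
    -- This keeps the outer radius `s ^ 2 / a'` of the flipped annulus at most `1`.
    have hsa' : s ^ 2 ≤ a' := by
      have : s ^ 2 ≤ a ^ 2 := by gcongr
      have : 0 ≤ s ^ 4 / a ^ 2 := by positivity
      linarith
    have hsb : s ^ 4 / b ^ 2 ≤ a ^ 2 := by
      refine le_trans ?_ hsa
      have : a ≤ b := by linarith
      gcongr
    have hratio : 4 * (b * a') ≤ b' * a := by
      have h1 : a' ≤ 2 * a ^ 2 := by linarith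
      have h2 : b ^ 2 - a ^ 2 ≤ b' := by linarith
      have h3 : b * a' ≤ b * (2 * a ^ 2) := by gcongr
      have h4 : (b ^ 2 - a ^ 2) * a ≤ b' * a := by gcongr
      have h5 : 8 * (b * a) ≤ b ^ 2 - a ^ 2 := by nlinarith
      nlinarith
    have hb'0 : 0 < b' := by
      have : 0 < b' * a := lt_of_lt_of_le (by positivity) hratio
      exact pos_of_mul_pos_left this ha0.le
    have hbig : 64 * a' ≤ b' := by
      nlinarith
    -- The ratio at least quadruples: one factor `2` pays for lowering `n`, the other for the
    -- truncations at radius `s` below.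
    have hgrow : 2 * a' < 2 ^ n * b' * s := by
      rw [pow_succ] at hn
      have h1 : a * (4 * (b * a')) < 2 ^ n * 2 * b * s * (b' * a) := by
        calc a * (4 * (b * a')) ≤ a * (b' * a) := by gcongr
          _ < 2 ^ n * 2 * b * s * (b' * a) := by gcongr
      have h2 : (2 * a * b) * (2 * a') < (2 * a * b) * (2 ^ n * b' * s) := by linarith
      exact lt_of_mul_lt_mul_left h2 (by positivity)
    rcases le_or_gt s a' with h1 | h1
    · exact ih a' b' h1 hb'1 (by linarith) (by linarith) himg
    have hsa'1 : s ^ 2 / a' ≤ 1 := by rwa [div_le_one ha'pos]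
    rcases le_or_gt b' s with h2 | h2
    · refine ih (s ^ 2 / b') (s ^ 2 / a') ?_ hsa'1 ?_ ?_ (himg.flip hs hc hX ha'pos hb'0)
      · rw [le_div_iff₀ hb'0]
        nlinarith
      · rw [mul_div_assoc', div_le_div_iff₀ hb'0 ha'pos]
        nlinarith [sq_nonneg s]
      · rw [div_lt_iff₀ hb'0]
        have : 2 ^ n * (s ^ 2 / a') * s * b' = s ^ 2 * ((2 ^ n * b' * s) / a') := by ring
        rw [this]
        have : 1 < (2 ^ n * b' * s) / a' := by
          rw [one_lt_div ha'pos]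
          linarith
        nlinarith [pow_pos hs 2]
    rcases le_or_gt (2 * s) b' with h3 | h3
    · rcases le_or_gt a' (s / 2) with h4 | h4
      · exact himg.mono h4 h3
      · refine ih s b' le_rfl hb'1 (by linarith) ?_ (himg.mono h1.le le_rfl)
        linarith
    -- Here `a' < s < b' < 2 * s`: dropping the part beyond `s` costs less than a factor `2`, and
    -- the rest is flipped outside.
    · refine ih s (s ^ 2 / a') le_rfl hsa'1 ?_ ?_ ?_
      · rw [le_div_iff₀ ha'pos]
        nlinarith
      · have : 2 ^ n * (s ^ 2 / a') * s = s * (2 ^ n * s * s / a') := by ring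
        rw [this]
        refine lt_mul_of_one_lt_right hs ?_
        rw [one_lt_div ha'pos]
        have : 2 ^ n * b' * s < 2 ^ n * (2 * s) * s := by gcongr
        linarith
      · have := (himg.mono le_rfl h2.le).flip hs hc hX ha'pos hs
        rwa [sq, mul_div_assoc, div_self hs.ne', mul_one, ← sq] at this

/-! ### Escaping and non-escaping points near the critical circle. -/

/-- `‖P.eval x‖` is the product of the distances from `x` to the roots, so these cannot all be at
least `r`. -/
theorem exists_isRoot_near {P : Polynomial ℂ} (hP : P.Monic) {x : ℂ} {r : ℝ} (hr : 0 ≤ r)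
    (h : ‖P.eval x‖ < r ^ P.natDegree) : ∃ p, P.IsRoot p ∧ ‖x - p‖ < r := by
  by_contra! hfar
  have hs := IsAlgClosed.splits P
  have key : ∀ m : Multiset ℂ, (∀ p ∈ m, r ≤ ‖x - p‖) →
      r ^ m.card ≤ ‖(m.map (fun p => x - p)).prod‖ := by
    intro m
    induction m using Multiset.induction_on with
    | empty => simp
    | cons p m ih =>
      intro hm
      simp only [Multiset.forall_mem_cons] at hm
      rw [Multiset.card_cons, Multiset.map_cons, Multiset.prod_cons, norm_mul, pow_succ']
      exact mul_le_mul hm.1 (ih hm.2) (by positivity) (norm_nonneg _)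
  have := key P.roots fun p hp => hfar p (Polynomial.isRoot_of_mem_roots hp)
  rw [← hs.natDegree_eq_card_roots] at this
  rw [hs.eval_eq_prod_roots_of_monic hP] at h
  linarith

theorem exists_fixedPoint {c : ℂ} (hc0 : c ≠ 0) (hc : ‖c‖ ≤ 1 / 32) :
    ∃ p : ℂ, 1 / 2 ≤ ‖p‖ ∧ singularMap c p = p := by
  open Polynomial in
  -- The fixed-point equation with denominators cleared; its value at `1` is `c`, of norm below `(1
  -- / 2) ^ 4`.
  have hdeg : (X ^ 4 - X ^ 3 + C c : ℂ[X]).natDegree = 4 := by compute_degree!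
  open Polynomial in
  have hmon : (X ^ 4 - X ^ 3 + C c : ℂ[X]).Monic := by monicity!
  obtain ⟨p, hp, hp1⟩ := exists_isRoot_near hmon (x := 1) (r := 1 / 2) (by norm_num) (by
    rw [hdeg]
    simp
    linarith)
  simp only [Polynomial.IsRoot, Polynomial.eval_add, Polynomial.eval_sub, Polynomial.eval_pow,
    Polynomial.eval_X, Polynomial.eval_C] at hp
  have hp0 : p ≠ 0 := by
    rintro rfl
    simp at hp
    exact hc0 hp
  refine ⟨p, ?_, ?_⟩
  · have := norm_sub_norm_le (1 : ℂ) p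
    rw [norm_one] at this
    linarith
  · rw [singularMap_coe hp0]
    congr 1
    field_simp
    linear_combination hp

theorem exists_mem_escapingSet {c : ℂ} {s : ℝ} (hs : 0 < s) (hc : ‖c‖ = s ^ 4) :
    ∃ z : ℂ, ‖z‖ = s ∧ (z : OnePoint ℂ) ∈ escapingSet (singularMap c) := by
  obtain ⟨z, hz⟩ := IsAlgClosed.exists_pow_nat_eq (-c) (n := 4) (by norm_num)
  have hzs : ‖z‖ = s := by
    rw [← pow_left_inj₀ (norm_nonneg z) hs.le (n := 4) (by norm_num), ← norm_pow, hz, norm_neg, hc]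
  have hz0 : z ≠ 0 := norm_pos_iff.1 (hzs ▸ hs)
  refine ⟨z, hzs, ?_⟩
  have h0 : z ^ 2 + c / z ^ 2 = 0 := by
    field_simp
    linear_combination hz
  rw [← mem_escapingSet_iff, singularMap_coe hz0, h0, ← mem_escapingSet_iff, singularMap_zero]
  exact infty_mem_escapingSet c

/-- The fixed point `p` has a preimage `q` near the pole, with `‖q‖ ≤ 2 * s ^ 2`. The outer preimage
of `q` is the required point, since `‖z‖ ≥ 2 * s` would give an image of norm at least `15 / 4 * s ^
2`. -/
theorem exists_notMem_escapingSet {c : ℂ} {s : ℝ} (hs : 0 < s) (hc : ‖c‖ = s ^ 4)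
    (hc1 : ‖c‖ ≤ 1 / 32) :
    ∃ z : ℂ, s ≤ ‖z‖ ∧ ‖z‖ < 2 * s ∧ (z : OnePoint ℂ) ∉ escapingSet (singularMap c) := by
  have hc0 : c ≠ 0 := norm_pos_iff.1 (by rw [hc]; positivity)
  obtain ⟨p, hp, hfix⟩ := exists_fixedPoint hc0 hc1
  obtain ⟨u, v, huv, hm, hle⟩ := exists_add_mul_eq c p
  have hv0 : v ≠ 0 := by
    rintro rfl
    simp at hm
    exact hc0 hm.symm
  have hu : 1 / 4 ≤ ‖u‖ := by
    have := norm_add_le u v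
    rw [huv] at this
    linarith
  have hv : ‖v‖ ≤ 4 * s ^ 4 := by
    have h1 : ‖u‖ * ‖v‖ = s ^ 4 := by rw [← norm_mul, hm, hc]
    nlinarith [norm_nonneg v]
  obtain ⟨q, hq⟩ := IsAlgClosed.exists_pow_nat_eq v (n := 2) (by norm_num)
  have hq0 : q ≠ 0 := by
    rintro rfl
    simp at hq
    exact hv0 hq.symm
  have hqs : ‖q‖ ≤ 2 * s ^ 2 := by
    rw [← hq, norm_pow] at hv
    refine (sq_le_sq₀ (norm_nonneg q) (by positivity)).1 ?_
    linarith
  obtain ⟨z, hsz, hzq⟩ := exists_preimage_norm_ge hs hc q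
  have hz0 : 0 < ‖z‖ := hs.trans_le hsz
  refine ⟨z, hsz, ?_, ?_⟩
  · by_contra! h
    have h1 := le_norm_image (z := z) hc
    rw [hzq] at h1
    have h2 : (2 * s) ^ 2 ≤ ‖z‖ ^ 2 := by gcongr
    have h3 : s ^ 4 / ‖z‖ ^ 2 ≤ s ^ 4 / (2 * s) ^ 2 := by gcongr
    have h4 : s ^ 4 / (2 * s) ^ 2 = s ^ 2 / 4 := by
      field_simp
      norm_num
    nlinarith [pow_pos hs 2]
  · have h1 : q ^ 2 + c / q ^ 2 = p := by
      rw [hq, ← huv, ← hm]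
      field_simp
      ring
    rw [← mem_escapingSet_iff, singularMap_coe (norm_pos_iff.1 hz0), hzq, ← mem_escapingSet_iff,
      singularMap_coe hq0, h1]
    exact coe_notMem_escapingSet_of_isFixedPt hfix

/-! ### Logarithmic coordinates: spreading a disk over an annulus. -/

/-- Away from the pole, the map is close to squaring: it has an inverse branch which in logarithmic
coordinates is close to halving. -/
theorem exists_log_preimage (R : ℝ) {η : ℝ} (hη : 0 < η) : ∃ γ : ℝ, 0 < γ ∧ ∀ c : ℂ, ‖c‖ ≤ γ →
    ∀ W : ℂ, -R ≤ W.re → ∃ L : ℂ, ‖L - W / 2‖ ≤ η ∧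
      singularMap c (Complex.exp L) = Complex.exp W := by
  set m := Real.exp (-R) with hm
  have hm0 : 0 < m := Real.exp_pos _
  refine ⟨m ^ 2 * min η 1 / 8, by positivity, fun c hc W hW => ?_⟩
  obtain ⟨u, v, huv, hmul, hle⟩ := exists_add_mul_eq c (Complex.exp W)
  have hw : m ≤ ‖Complex.exp W‖ := by rwa [Complex.norm_exp, hm, Real.exp_le_exp]
  have hu : m / 2 ≤ ‖u‖ := by
    have := norm_add_le u v
    rw [huv] at this
    linarith
  have hupos : 0 < ‖u‖ := by linarith
  have hu0 : u ≠ 0 := norm_pos_iff.1 hupos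
  have ht : ‖v / u‖ ≤ min η 1 / 2 := by
    have h1 : v / u = c / u ^ 2 := by
      rw [← hmul]
      field_simp
    rw [h1, norm_div, norm_pow, div_le_iff₀ (by positivity)]
    have h2 : (m / 2) ^ 2 ≤ ‖u‖ ^ 2 := by gcongr
    have h3 : 0 < min η 1 := by positivity
    nlinarith
  have hη1 := min_le_left η 1
  have hη2 := min_le_right η 1
  have hlog := Complex.norm_log_one_add_half_le_self (z := v / u) (by linarith)
  have hne : 1 + v / u ≠ 0 := by
    rw [← div_self hu0, ← add_div, huv]
    exact div_ne_zero (Complex.exp_ne_zero _) hu0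
  -- Since `exp W = u * (1 + v / u)`, this makes `exp L` a square root of the larger summand `u`.
  set L := (W - Complex.log (1 + v / u)) / 2 with hL
  refine ⟨L, ?_, ?_⟩
  · have : L - W / 2 = -(Complex.log (1 + v / u) / 2) := by rw [hL]; ring
    rw [this, norm_neg, norm_div, Complex.norm_ofNat]
    linarith
  · have h2 : Complex.exp L ^ 2 = u := by
      rw [← Complex.exp_nat_mul]
      have : ((2 : ℕ) : ℂ) * L = W - Complex.log (1 + v / u) := by
        rw [hL]
        push_cast
        ring
      rw [this, Complex.exp_sub, Complex.exp_log hne, ← huv, div_eq_iff hne]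
      field_simp
    rw [singularMap_coe (Complex.exp_ne_zero L), h2, ← huv, ← hmul, mul_div_cancel_left₀ _ hu0]

theorem exists_log_preimage_iterate (k : ℕ) : ∀ {R η : ℝ}, 0 ≤ R → 0 < η → ∃ γ : ℝ, 0 < γ ∧
    ∀ c : ℂ, ‖c‖ ≤ γ → ∀ W : ℂ, -R ≤ W.re → ∃ L : ℂ, ‖L - W / 2 ^ k‖ ≤ η ∧
      (singularMap c)^[k] (Complex.exp L) = Complex.exp W := by
  induction k with
  | zero =>
    intro R η _ hη
    exact ⟨1, one_pos, fun c _ W _ => ⟨W, by simpa using hη.le, rfl⟩⟩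
  | succ k ih =>
    intro R η hR hη
    obtain ⟨γ₁, hγ₁, h₁⟩ := exists_log_preimage R (η := min (η / 2) 1) (by positivity)
    -- One pullback halves the real part up to an error of at most `1`, hence `R + 1`.
    obtain ⟨γ₂, hγ₂, h₂⟩ := ih (R := R + 1) (η := η / 2) (by positivity) (by positivity)
    refine ⟨min γ₁ γ₂, by positivity, fun c hc W hW => ?_⟩
    obtain ⟨M, hM, hMW⟩ := h₁ c (hc.trans (min_le_left _ _)) W hW
    have hM1 := hM.trans (min_le_left _ _)
    have hM2 := hM.trans (min_le_right _ _)
    have hre : -(R + 1) ≤ M.re := by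
      have h1 := (Complex.abs_re_le_norm (M - W / 2)).trans hM2
      have h2 : (M - W / 2).re = M.re - W.re / 2 := by simp
      rw [h2, abs_le] at h1
      linarith [h1.1]
    obtain ⟨L, hL, hLM⟩ := h₂ c (hc.trans (min_le_right _ _)) M hre
    refine ⟨L, ?_, by rw [Function.iterate_succ_apply', hLM, hMW]⟩
    have h3 : L - W / 2 ^ (k + 1) = (L - M / 2 ^ k) + (M - W / 2) / 2 ^ k := by
      rw [pow_succ]
      field_simp
      ring
    have h4 : ‖(M - W / 2) / 2 ^ k‖ ≤ η / 2 := by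
      rw [norm_div, norm_pow, Complex.norm_ofNat]
      exact (div_le_self (norm_nonneg _) (one_le_pow₀ one_le_two)).trans hM1
    rw [h3]
    exact (norm_add_le _ _).trans (by linarith)

theorem exists_exp_eq_im_near (y : ℝ) {w : ℂ} (hw : w ≠ 0) :
    ∃ W : ℂ, Complex.exp W = w ∧ W.re = Real.log ‖w‖ ∧ |W.im - y| ≤ Real.pi := by
  have h0 : Complex.exp (-(y * Complex.I)) ≠ 0 := Complex.exp_ne_zero _
  refine ⟨Complex.log (w * Complex.exp (-(y * Complex.I))) + y * Complex.I, ?_, ?_, ?_⟩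
  · rw [Complex.exp_add, Complex.exp_log (mul_ne_zero hw h0), mul_assoc, ← Complex.exp_add]
    simp
  · simp [Complex.log_re, Complex.norm_exp]
  · simp only [Complex.add_im, Complex.log_im, Complex.mul_im, Complex.ofReal_re, Complex.I_im,
      Complex.ofReal_im, Complex.I_re, mul_one, mul_zero, add_zero, add_sub_cancel_right]
    exact Complex.abs_arg_le_pi _

/-- Some iterate spreads any disk meeting the punctured unit disk over a thick round annulus,
uniformly for small parameters. -/
theorem exists_containsAnnulus_of_exp {L₀ : ℂ} {δ : ℝ} (hL₀ : L₀.re < 0) (hδ : 0 < δ) :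
    ∃ a b γ : ℝ, 0 < a ∧ b ≤ 1 ∧ 16 * a ≤ b ∧ 0 < γ ∧ ∀ c : ℂ, ‖c‖ ≤ γ →
      ∀ X : Set (OnePoint ℂ), (∀ x, singularMap c x ∈ X ↔ x ∈ X) →
        (∀ L : ℂ, ‖L - L₀‖ < δ → ((Complex.exp L : ℂ) : OnePoint ℂ) ∈ X) →
          ContainsAnnulus X a b := by
  -- `2 ^ k * δ > 32` gives the ratio `exp (2 ^ k * δ / 2) ≥ 16`, and makes the argument error `π <
  -- 4` less than `δ / 8` after division by `2 ^ k`.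
  obtain ⟨k, hk⟩ := pow_unbounded_of_one_lt (32 / δ) (one_lt_two (α := ℝ))
  rw [div_lt_iff₀ hδ] at hk
  have hk0 : (0 : ℝ) < 2 ^ k := by positivity
  have hneg : 2 ^ k * L₀.re < 0 := mul_neg_of_pos_of_neg hk0 hL₀
  obtain ⟨γ, hγ, h⟩ := exists_log_preimage_iterate k
    (R := -(2 ^ k * (L₀.re - δ / 2))) (η := δ / 8) (by nlinarith) (by positivity)
  refine ⟨Real.exp (2 ^ k * (L₀.re - δ / 2)), Real.exp (2 ^ k * L₀.re), γ, Real.exp_pos _,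
    Real.exp_le_one_iff.2 hneg.le, ?_, hγ, fun c hc X hX hL w h1 h2 => ?_⟩
  · have h16 : (16 : ℝ) ≤ Real.exp (2 ^ k * (δ / 2)) := by
      have := Real.add_one_le_exp (2 ^ k * (δ / 2))
      linarith
    calc 16 * Real.exp (2 ^ k * (L₀.re - δ / 2))
        ≤ Real.exp (2 ^ k * (δ / 2)) * Real.exp (2 ^ k * (L₀.re - δ / 2)) := by gcongr
      _ = Real.exp (2 ^ k * L₀.re) := by
        rw [← Real.exp_add]
        congr 1
        ring
  · have hwpos : 0 < ‖w‖ := (Real.exp_pos _).trans h1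
    obtain ⟨W, hW, hre, him⟩ := exists_exp_eq_im_near (2 ^ k * L₀.im) (norm_pos_iff.1 hwpos)
    rw [← Real.lt_log_iff_exp_lt hwpos, ← hre] at h1
    rw [← Real.log_lt_iff_lt_exp hwpos, ← hre] at h2
    obtain ⟨L, hLW, hF⟩ := h c hc W (by linarith)
    have hiter : ∀ (n : ℕ) (x : OnePoint ℂ), (singularMap c)^[n] x ∈ X ↔ x ∈ X := by
      intro n
      induction n with
      | zero => exact fun x => Iff.rfl
      | succ n ih => exact fun x => by rw [Function.iterate_succ_apply, ih, hX]
    rw [← hW, ← hF, hiter]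
    apply hL
    have h3 : ‖W / 2 ^ k - L₀‖ < 3 * δ / 4 := by
      have h4 : W / 2 ^ k - L₀ = (W - 2 ^ k * L₀) / 2 ^ k := by
        field_simp
      rw [h4, norm_div, norm_pow, Complex.norm_ofNat, div_lt_iff₀ hk0]
      have h5 := Complex.norm_le_abs_re_add_abs_im (W - 2 ^ k * L₀)
      have hcast : (2 ^ k : ℂ) = ((2 ^ k : ℝ) : ℂ) := by push_cast; rfl
      rw [hcast, Complex.sub_re, Complex.sub_im, Complex.re_ofReal_mul, Complex.im_ofReal_mul] at h5
      rw [hcast]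
      have h6 : |W.re - 2 ^ k * L₀.re| ≤ 2 ^ k * (δ / 2) := abs_le.2 ⟨by linarith, by nlinarith⟩
      have := Real.pi_lt_four
      nlinarith
    have h7 : L - L₀ = (L - W / 2 ^ k) + (W / 2 ^ k - L₀) := by ring
    rw [h7]
    exact (norm_add_le _ _).trans_lt (by linarith)

theorem exists_exp_mem_ball {z : ℂ} (hz : ‖z‖ ≤ 1) {r : ℝ} (hr : 0 < r) :
    ∃ L₀ : ℂ, ∃ δ : ℝ, L₀.re < 0 ∧ 0 < δ ∧
      ∀ L : ℂ, ‖L - L₀‖ < δ → Complex.exp L ∈ Metric.ball z r := by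
  -- The centre may be `0` or lie on the unit circle; it is moved to a point whose logarithm exists
  -- and has negative real part.
  obtain ⟨w, hwz, hw0, hw1⟩ : ∃ w ∈ Metric.ball z r, w ≠ 0 ∧ ‖w‖ < 1 := by
    rcases eq_or_ne z 0 with rfl | h0
    · have ht : 0 < min (r / 2) (1 / 2) := by positivity
      refine ⟨(min (r / 2) (1 / 2) : ℝ), ?_, by exact_mod_cast ht.ne', ?_⟩
      · rw [mem_ball_zero_iff, Complex.norm_real, Real.norm_of_nonneg ht.le]
        exact (min_le_left _ _).trans_lt (by linarith)
      · rw [Complex.norm_real, Real.norm_of_nonneg ht.le]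
        exact (min_le_right _ _).trans_lt (by norm_num)
    · have ht : 0 < min (r / 2) (1 / 2) := by positivity
      have ht2 := min_le_right (r / 2) (1 / 2)
      have ht1 := min_le_left (r / 2) (1 / 2)
      set t := min (r / 2) (1 / 2)
      have hzpos : 0 < ‖z‖ := norm_pos_iff.2 h0
      refine ⟨((1 - t : ℝ) : ℂ) * z, ?_, mul_ne_zero ?_ h0, ?_⟩
      · have : ((1 - t : ℝ) : ℂ) * z - z = -((t : ℂ) * z) := by push_cast; ring
        rw [mem_ball_iff_norm, this, norm_neg, norm_mul, Complex.norm_real,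
          Real.norm_of_nonneg ht.le]
        nlinarith
      · exact Complex.ofReal_ne_zero.2 (by linarith : 0 < 1 - t).ne'
      · rw [norm_mul, Complex.norm_real, Real.norm_of_nonneg (by linarith)]
        nlinarith
  have hcont : Complex.exp ⁻¹' Metric.ball z r ∈ nhds (Complex.log w) := by
    refine (Metric.isOpen_ball.preimage Complex.continuous_exp).mem_nhds ?_
    rwa [Set.mem_preimage, Complex.exp_log hw0]
  obtain ⟨δ, hδ, hsub⟩ := Metric.mem_nhds_iff.1 hcont
  refine ⟨Complex.log w, δ, ?_, hδ, fun L hL => hsub (mem_ball_iff_norm.2 hL)⟩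
  rw [Complex.log_re]
  exact Real.log_neg (norm_pos_iff.2 hw0) hw1

/-! ### Conclusion by connectedness and compactness. -/

theorem IsPreconnected.inter_frontier_nonempty_of_not_subset {α : Type*} [TopologicalSpace α]
    {t s : Set α} (ht : IsPreconnected t) (h1 : ¬ t ⊆ s) (h2 : ¬ t ⊆ sᶜ) :
    (frontier s ∩ t).Nonempty := by
  by_contra hne
  have hdisj : ∀ x ∈ t, x ∉ frontier s := fun x hx hf => hne ⟨x, hf, hx⟩
  have hcover : t ⊆ interior s ∪ interior sᶜ := by
    intro x hx
    rw [interior_compl]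
    by_cases h : x ∈ closure s
    · exact Or.inl (by_contra fun hi => hdisj x hx ⟨h, hi⟩)
    · exact Or.inr h
  have hd : Disjoint (interior s) (interior sᶜ) :=
    disjoint_compl_right.mono interior_subset interior_subset
  rcases ht.subset_or_subset isOpen_interior isOpen_interior hd hcover with h | h
  · exact h1 (h.trans interior_subset)
  · exact h2 (h.trans interior_subset)

theorem exists_juliaSet_inter_ball_nonempty {z : ℂ} (hz : ‖z‖ ≤ 1) {r : ℝ} (hr : 0 < r) :
    ∃ γ : ℝ, 0 < γ ∧ ∀ c : ℂ, 0 < ‖c‖ → ‖c‖ ≤ γ →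
      (juliaSet (singularMap c) ∩ ((↑) : ℂ → OnePoint ℂ) '' Metric.ball z r).Nonempty := by
  obtain ⟨L₀, δ, hL₀, hδ, hball⟩ := exists_exp_mem_ball hz hr
  obtain ⟨a, b, γ, ha, hb, hab, hγ, hann⟩ := exists_containsAnnulus_of_exp hL₀ hδ
  -- `a ^ 4` puts the annulus outside the critical circle (`s ≤ a`); `1 / 32` provides the fixed
  -- point.
  refine ⟨min γ (min (a ^ 4) (1 / 32)), by positivity, fun c hc0 hc => ?_⟩
  have hc1 : ‖c‖ ≤ γ := hc.trans (min_le_left _ _)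
  have hc2 : ‖c‖ ≤ a ^ 4 := hc.trans ((min_le_right _ _).trans (min_le_left _ _))
  have hc3 : ‖c‖ ≤ 1 / 32 := hc.trans ((min_le_right _ _).trans (min_le_right _ _))
  obtain ⟨s, hs, hcs⟩ : ∃ s : ℝ, 0 < s ∧ ‖c‖ = s ^ 4 :=
    ⟨‖c‖ ^ (1 / 4 : ℝ), by positivity, by
      rw [← Real.rpow_natCast, ← Real.rpow_mul hc0.le]
      norm_num⟩
  have hsa : s ≤ a := by
    rw [hcs] at hc2
    exact (pow_le_pow_iff_left₀ hs.le ha.le (by norm_num)).1 hc2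
  have key : ∀ X : Set (OnePoint ℂ), (∀ x, singularMap c x ∈ X ↔ x ∈ X) →
      ((↑) : ℂ → OnePoint ℂ) '' Metric.ball z r ⊆ X → ContainsAnnulus X (s / 2) (2 * s) := by
    intro X hX hsub
    have h := hann c hc1 X hX fun L hL => hsub ⟨_, hball L hL, rfl⟩
    have hb0 : 0 < b := by linarith
    -- `n` may depend on `c`: only the initial annulus has to be uniform.
    obtain ⟨n, hn⟩ := pow_unbounded_of_one_lt (a / (b * s)) (one_lt_two (α := ℝ))
    rw [div_lt_iff₀ (by positivity), ← mul_assoc] at hn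
    exact h.critical hs hcs hX n a b hsa hb hab hn
  apply IsPreconnected.inter_frontier_nonempty_of_not_subset
  · exact (convex_ball z r).isPreconnected.image _ OnePoint.continuous_coe.continuousOn
  · intro hsub
    obtain ⟨w, h1, h2, hw⟩ := exists_notMem_escapingSet hs hcs hc3
    exact hw (key _ (mem_escapingSet_iff _) hsub w (by linarith) h2)
  · intro hsub
    obtain ⟨w, h1, hw⟩ := exists_mem_escapingSet hs hcs
    exact key _ (fun x => not_congr (mem_escapingSet_iff _ x)) hsub w (by linarith)
      (by linarith) hw

theorem theorem3p11 (ε : ℝ) (hε : 0 < ε) :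
    ∃ γ : ℝ, 0 < γ ∧ ∀ c : ℂ, 0 < ‖c‖ → ‖c‖ ≤ γ →
      ∀ z ∈ Metric.closedBall (0 : ℂ) 1,
        (juliaSet (singularMap c) ∩ ((↑) : ℂ → OnePoint ℂ) '' Metric.ball z ε).Nonempty := by
  refine (isCompact_closedBall (0 : ℂ) 1).induction_on
    (p := fun S => ∃ γ : ℝ, 0 < γ ∧ ∀ c : ℂ, 0 < ‖c‖ → ‖c‖ ≤ γ → ∀ z ∈ S,
      (juliaSet (singularMap c) ∩ ((↑) : ℂ → OnePoint ℂ) '' Metric.ball z ε).Nonempty)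
    ⟨1, one_pos, by simp⟩ ?_ ?_ ?_
  · rintro S T hST ⟨γ, hγ, h⟩
    exact ⟨γ, hγ, fun c h0 h1 z hz => h c h0 h1 z (hST hz)⟩
  · rintro S T ⟨γ₁, hγ₁, h₁⟩ ⟨γ₂, hγ₂, h₂⟩
    refine ⟨min γ₁ γ₂, lt_min hγ₁ hγ₂, fun c h0 hc z hz => ?_⟩
    rcases hz with hz | hz
    · exact h₁ c h0 (hc.trans (min_le_left _ _)) z hz
    · exact h₂ c h0 (hc.trans (min_le_right _ _)) z hz
  · intro z hz
    obtain ⟨γ, hγ, h⟩ := exists_juliaSet_inter_ball_nonempty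
      (mem_closedBall_zero_iff.1 hz) (half_pos hε)
    refine ⟨Metric.ball z (ε / 2), mem_nhdsWithin_of_mem_nhds (Metric.ball_mem_nhds z (half_pos hε)),
      γ, hγ, fun c h0 hc w hw => (h c h0 hc).mono ?_⟩
    refine Set.inter_subset_inter_right _ (Set.image_mono ?_)
    refine Metric.ball_subset_ball' ?_
    rw [Metric.mem_ball, dist_comm] at hw
    linarith
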